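/- **Setting.** Fix a first-order language, possibly with an equality predicate $\approx$. *Interpretations* are first-order interpretations under the standard name assumption: Herbrand interpretations over the language extended by countably many additional constants, with $\approx$ (if present) interpreted as a congruence; $\models$, satisfiability and "set of models" refer to these. A *hybrid MKNF knowledge base* $\mathcal K=(\mathcal O,\mathcal P)$ consists of an ontology $\mathcal O$, translated into a first-order sentence $\pi(\mathcal O)$, and a finite set $\mathcal P$ of ground rules $r$ of the form $\mathbf K H\leftarrow \mathbf K A_1,\dots,\mathbf K A_m,\mathbf{not}\,B_1,\dots,\mathbf{not}\,B_n$, where $H,A_i,B_j$ are ground function-free atoms; $hd(r)=\mathbf K H$, $bd^+(r)=\{\mathbf K A_i\}$, $bd^-(r)=\{B_j\}$. Let $\pi(\mathcal K)=\mathbf K\,\pi(\mathcal O)\wedge\bigwedge_{r\in\mathcal P}(\mathbf K A_1\wedge\dots\wedge\mathbf K A_m\wedge\mathbf{not}\,B_1\wedge\dots\wedge\mathbf{not}\,B_n\supset\mathbf K H)$. Let $\mathsf{KA}(\mathcal K)$ be the set of all $\mathbf K\phi$ such that $\mathbf K\phi$ or $\mathbf{not}\,\phi$ occurs in $\mathcal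 P$; for a set $S$ of atoms put $\mathbf K(S)=\{\mathbf K\phi\mid\phi\in S\}$, and for $S\subseteq\mathsf{KA}(\mathcal K)$ put $\mathsf{OB}_{\mathcal O,S}=\{\pi(\mathcal O)\}\cup\{\xi\mid\mathbf K\xi\in S\}$. A *partition* is a pair $(T,P)$ with $T,P\subseteq\mathsf{KA}(\mathcal K)$. **Three-valued models.** Truth values are ordered $\mathbf f<\mathbf u<\mathbf t$. For sets of interpretations $M_1\subseteq M$, $N_1\subseteq N$, the value $(I,\langle M,M_1\rangle,\langle N,N_1\rangle)(\varphi)$ of an MKNF formula is that of $I$ on atoms; $\neg$ exchanges $\mathbf t$ and $\mathbf f$ and fixes $\mathbf u$; $\wedge$ is the minimum; $\exists$ is the maximum over all names; $\varphi\supset\psi$ is $\mathbf t$ if the value of $\psi$ is at least that of $\varphi$, and $\mathbf f$ otherwise; $\mathbf K\varphi$ is $\mathbf t$ if $\varphi$ is $\mathbf t$ at all $J\in M$, $\mathbf f$ if $\varphi$ is $\mathbf f$ at some $J\in M_1$, and $\mathbf u$ otherwise; $\mathbf{not}\,\varphi$ is $\mathbf t$ if $\varphi$ is $\mathbf f$ at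 some $J\in N_1$, $\mathbf f$ if $\varphi$ is $\mathbf t$ at all $J\in N$, and $\mathbf u$ otherwise. An *MKNF interpretation pair* is a pair $(M,N)$ of sets of interpretations with $\emptyset\subset N\subseteq M$. It is a *three-valued MKNF model* of $\mathcal K$ if (a) $(I,\langle M,N\rangle,\langle M,N\rangle)(\pi(\mathcal K))=\mathbf t$ for all $I\in M$, and (b) for every MKNF interpretation pair $(M',N')$ with $M\subseteq M'$, $N\subseteq N'$, at least one inclusion proper, and $M'=N'$ if $M=N$, there is $I'\in M'$ with $(I',\langle M',N'\rangle,\langle M,N\rangle)(\pi(\mathcal K))\neq\mathbf t$. The partition $(T,P)$ is *induced* by an interpretation pair $(M,N)$ if for every $\mathbf K\xi\in\mathsf{KA}(\mathcal K)$, the value of $\mathbf K\xi$ with respect to $(M,N)$ is $\mathbf t$ iff $\mathbf K\xi\in T$, is $\mathbf f$ iff $\mathbf K\xi\notin P$, and is $\mathbf u$ iff $\mathbf K\xi\in P\setminus T$. **The approximator.** $\Phi_{\mathcal K}(T,P)=(\Phi_{\mathcal K}(T,P)_1,\Phi_{\mathcal K}(T,P)_2)$ with $$\Phi_{\mathcal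 K}(T,P)_1=\{\mathbf Ka\in\mathsf{KA}(\mathcal K)\mid\mathsf{OB}_{\mathcal O,T}\models a\}\cup\{hd(r)\mid r\in\mathcal P,\ bd^+(r)\subseteq T,\ \mathbf K(bd^-(r))\cap P=\emptyset\},$$ $$\Phi_{\mathcal K}(T,P)_2=\{\mathbf Ka\in\mathsf{KA}(\mathcal K)\mid\mathsf{OB}_{\mathcal O,P}\models a\}\cup\{hd(r)\mid r\in\mathcal P,\ hd(r)=\mathbf Ka,\ \mathsf{OB}_{\mathcal O,T}\not\models\neg a,\ bd^+(r)\subseteq P,\ \mathbf K(bd^-(r))\cap T=\emptyset\}.$$ A partition $(T,P)$ is a *consistent stable fixpoint* of $\Phi_{\mathcal K}$ if $T\subseteq P$, $\Phi_{\mathcal K}(\cdot,P)_1$ maps $[\emptyset,P]$ into itself and $T$ is its least fixpoint there, and $\Phi_{\mathcal K}(T,\cdot)_2$ maps $[T,\mathsf{KA}(\mathcal K)]$ into itself and $P$ is its least fixpoint there. **Theorem.** Let $\mathcal K=(\mathcal O,\mathcal P)$ be a hybrid MKNF knowledge base, $(T,P)$ a partition, and $(M,N)=(\{I\mid I\models\mathsf{OB}_{\mathcal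 O,T}\},\{I\mid I\models\mathsf{OB}_{\mathcal O,P}\})$. Then $(M,N)$ is a three-valued MKNF model of $\mathcal K$ whose induced partition is $(T,P)$ if and only if $(T,P)$ is a consistent stable fixpoint of $\Phi_{\mathcal K}$ and $\mathsf{OB}_{\mathcal O,\mathrm{lfp}(\Phi_{\mathcal K}(\cdot,T)_1)}$ is satisfiable, where the least fixpoint is taken in $2^{\mathsf{KA}(\mathcal K)}$. -/

import Mathlib

namespace MKNF

universe u v

/-! ### Truth values -/

/-- The three truth values false, undefined, true. -/
inductive TV : Type
  | f
  | u
  | t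

/-- The rank of a truth value in the order `f < u < t`. -/
def TV.rank : TV → ℕ
  | TV.f => 0
  | TV.u => 1
  | TV.t => 2

theorem TV.rank_injective : Function.Injective TV.rank := by
  intro a b h
  cases a <;> cases b <;> simp_all [TV.rank]

/-- The order `f < u < t`. -/
instance : LinearOrder TV := LinearOrder.lift' TV.rank TV.rank_injective

/-! ### Interpretations under the standard name assumption -/

section Formulas

variable (L : FirstOrder.Language.{u, v})

/-- The universe of all interpretations: the ground terms of the language extended by countably
infinitely many additional constants. The elements of `ℕ` are these additional constants, and every
element of the universe is its own name. -/
abbrev Univ := L.Term ℕ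

/-- An interpretation under the standard name assumption: a Herbrand interpretation over `Univ L`.
The language possibly has an equality predicate `eqv`; if it does, then that predicate is
interpreted as a congruence relation. -/
structure Interp (eqv : Option (L.Relations 2)) where
  /-- the extension of each predicate -/
  rel : ∀ {k : ℕ}, L.Relations k → (Fin k → Univ L) → Prop
  /-- equality is an equivalence relation -/
  eqv_equiv : ∀ e ∈ eqv, Equivalence (fun x y : Univ L => rel e ![x, y])
  /-- equality is compatible with functions -/
  eqv_func : ∀ e ∈ eqv, ∀ {k : ℕ} (g : L.Functions k) (x y : Fin k → Univ L),
    (∀ i, rel e ![x i, y i]) →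
      rel e ![FirstOrder.Language.Term.func g x, FirstOrder.Language.Term.func g y]
  /-- equality is compatible with predicates -/
  eqv_rel : ∀ e ∈ eqv, ∀ {k : ℕ} (R : L.Relations k) (x y : Fin k → Univ L),
    (∀ i, rel e ![x i, y i]) → (rel R x ↔ rel R y)

/-! ### Formulas -/

/-- First-order formulas with free variables among `0, …, n - 1`. In `ex φ` the bound variable is
the last one of `φ`. Disjunction, falsity and universal quantification are the usual
abbreviations. -/
inductive FOFormula : ℕ → Type (max u v)
  | top {n : ℕ} : FOFormula n
  | rel {n k : ℕ} (R : L.Relations k) (ts : Fin k → L.Term (Fin n)) : FOFormula n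
  | neg {n : ℕ} (φ : FOFormula n) : FOFormula n
  | conj {n : ℕ} (φ ψ : FOFormula n) : FOFormula n
  | impl {n : ℕ} (φ ψ : FOFormula n) : FOFormula n
  | ex {n : ℕ} (φ : FOFormula (n + 1)) : FOFormula n

/-- MKNF formulas with free variables among `0, …, n - 1`: first-order formulas with the two
modal operators `know` (minimal knowledge) and `naf` (negation as failure). -/
inductive Formula : ℕ → Type (max u v)
  | top {n : ℕ} : Formula n
  | rel {n k : ℕ} (R : L.Relations k) (ts : Fin k → L.Term (Fin n)) : Formula n
  | neg {n : ℕ} (φ : Formula n) : Formula n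
  | conj {n : ℕ} (φ ψ : Formula n) : Formula n
  | impl {n : ℕ} (φ ψ : Formula n) : Formula n
  | ex {n : ℕ} (φ : Formula (n + 1)) : Formula n
  | know {n : ℕ} (φ : Formula n) : Formula n
  | naf {n : ℕ} (φ : Formula n) : Formula n

/-- Ground function-free first-order atoms: a predicate applied to constants. -/
structure GroundAtom where
  /-- number of arguments -/
  arity : ℕ
  /-- the predicate -/
  pred : L.Relations arity
  /-- the arguments -/
  args : Fin arity → L.Constants

/-- A ground rule `K head ← K A₁, …, K Aₘ, not B₁, …, not Bₙ`. -/
structure Rule where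
  /-- the atom `H` of the head `K H` -/
  head : GroundAtom L
  /-- the atoms `A₁, …, Aₘ` -/
  pos : List (GroundAtom L)
  /-- the atoms `B₁, …, Bₙ` -/
  neg : List (GroundAtom L)

/-- A hybrid MKNF knowledge base: an ontology, given by its translation into a first-order
sentence, and a finite set of ground rules. -/
structure KB where
  /-- the first-order translation of the ontology -/
  onto : FOFormula L 0
  /-- the rule base -/
  rules : Finset (Rule L)

end Formulas

variable {L : FirstOrder.Language.{u, v}} {eqv : Option (L.Relations 2)}

/-! ### Semantics -/

/-- Classical truth of a first-order formula in an interpretation, the free variables being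
replaced by the names `x`. -/
def FOFormula.Realize (I : Interp L eqv) : {n : ℕ} → FOFormula L n → (Fin n → Univ L) → Prop
  | _, .top, _ => True
  | _, .rel R ts, x => I.rel R (fun i => (ts i).subst x)
  | _, .neg φ, x => ¬ φ.Realize I x
  | _, .conj φ ψ, x => φ.Realize I x ∧ ψ.Realize I x
  | _, .impl φ ψ, x => φ.Realize I x → ψ.Realize I x
  | _, .ex φ, x => ∃ α : Univ L, φ.Realize I (Fin.snoc x α)

/-- A first-order sentence is true in an interpretation. -/
def Interp.Models (I : Interp L eqv) (φ : FOFormula L 0) : Prop := φ.Realize I Fin.elim0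

/-- A first-order formula, read as an MKNF formula. -/
def FOFormula.toFormula : {n : ℕ} → FOFormula L n → Formula L n
  | _, .top => .top
  | _, .rel R ts => .rel R ts
  | _, .neg φ => .neg φ.toFormula
  | _, .conj φ ψ => .conj φ.toFormula ψ.toFormula
  | _, .impl φ ψ => .impl φ.toFormula ψ.toFormula
  | _, .ex φ => .ex φ.toFormula

open Classical in
/-- The value of an MKNF formula in the three-valued MKNF structure `(I, 𝓜, 𝓝)`, where
`𝓜 = ⟨M, M₁⟩` and `𝓝 = ⟨N, N₁⟩`, the free variables being replaced by the names `x`. The value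
of `ex φ` is the greatest of the values of the instances of `φ`. -/
noncomputable def Formula.eval (MM NN : Set (Interp L eqv) × Set (Interp L eqv)) :
    {n : ℕ} → Formula L n → Interp L eqv → (Fin n → Univ L) → TV
  | _, .top, _, _ => TV.t
  | _, .rel R ts, I, x => if I.rel R (fun i => (ts i).subst x) then TV.t else TV.f
  | _, .neg φ, I, x =>
      match φ.eval MM NN I x with
      | TV.f => TV.t
      | TV.u => TV.u
      | TV.t => TV.f
  | _, .conj φ ψ, I, x => min (φ.eval MM NN I x) (ψ.eval MM NN I x)
  | _, .impl φ ψ, I, x => if φ.eval MM NN I x ≤ ψ.eval MM NN I x then TV.t else TV.f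
  | _, .ex φ, I, x =>
      if ∃ α : Univ L, φ.eval MM NN I (Fin.snoc x α) = TV.t then TV.t
      else if ∃ α : Univ L, φ.eval MM NN I (Fin.snoc x α) = TV.u then TV.u
      else TV.f
  | _, .know φ, _, x =>
      if ∀ J ∈ MM.1, φ.eval MM NN J x = TV.t then TV.t
      else if ∃ J ∈ MM.2, φ.eval MM NN J x = TV.f then TV.f
      else TV.u
  | _, .naf φ, _, x =>
      if ∃ J ∈ NN.2, φ.eval MM NN J x = TV.f then TV.t
      else if ∀ J ∈ NN.1, φ.eval MM NN J x = TV.t then TV.f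
      else TV.u

/-- The value of an MKNF sentence in a three-valued MKNF structure. -/
noncomputable def Formula.value (φ : Formula L 0) (I : Interp L eqv)
    (MM NN : Set (Interp L eqv) × Set (Interp L eqv)) : TV :=
  φ.eval MM NN I Fin.elim0

/-- `(M, N)` is an MKNF interpretation pair: `∅ ⊂ N ⊆ M`. -/
def IsInterpPair (M N : Set (Interp L eqv)) : Prop := N.Nonempty ∧ N ⊆ M

/-- The interpretation pair `(M, N)` satisfies the MKNF sentence `φ`. -/
def Satisfies (M N : Set (Interp L eqv)) (φ : Formula L 0) : Prop :=
  ∀ I ∈ M, φ.value I (M, N) (M, N) = TV.t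

/-- `(M, N)` is a three-valued MKNF model of the MKNF sentence `φ`. -/
def IsThreeValuedModel (M N : Set (Interp L eqv)) (φ : Formula L 0) : Prop :=
  IsInterpPair M N ∧ Satisfies M N φ ∧
    ∀ M' N' : Set (Interp L eqv), IsInterpPair M' N' → M ⊆ M' → N ⊆ N' →
      (M ≠ M' ∨ N ≠ N') → (M = N → M' = N') →
        ∃ I' ∈ M', φ.value I' (M', N') (M, N) ≠ TV.t

/-! ### Hybrid MKNF knowledge bases -/

/-- A ground atom as a first-order sentence. -/
def GroundAtom.toFO (a : GroundAtom L) : FOFormula L 0 :=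
  .rel a.pred (fun i => (a.args i).term)

/-- The modal atom `K a` as an MKNF sentence. -/
def GroundAtom.know (a : GroundAtom L) : Formula L 0 := .know a.toFO.toFormula

/-- The modal atom `not a` as an MKNF sentence. -/
def GroundAtom.naf (a : GroundAtom L) : Formula L 0 := .naf a.toFO.toFormula

/-- The conjunction of a list of MKNF sentences. -/
def bigConj (l : List (Formula L 0)) : Formula L 0 := l.foldr Formula.conj Formula.top

/-- The MKNF sentence of a ground rule. -/
def Rule.toFormula (r : Rule L) : Formula L 0 :=
  .impl (bigConj (r.pos.map GroundAtom.know ++ r.neg.map GroundAtom.naf)) r.head.know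

namespace KB

/-- The MKNF sentence of a knowledge base: the conjunction of `K` applied to the ontology and of
all rules. -/
noncomputable def toFormula (K : KB L) : Formula L 0 :=
  .conj (.know K.onto.toFormula) (bigConj (K.rules.toList.map Rule.toFormula))

/-- The set of `K`-atoms of a knowledge base. The modal atom `K a` is represented by `a`. -/
def KA (K : KB L) : Set (GroundAtom L) :=
  {a | ∃ r ∈ K.rules, a = r.head ∨ a ∈ r.pos ∨ a ∈ r.neg}

/-- The objective knowledge of a set of `K`-atoms. -/
def OB (K : KB L) (S : Set K.KA) : Set (FOFormula L 0) :=
  {K.onto} ∪ {φ | ∃ a ∈ S, φ = a.val.toFO}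

end KB

variable (eqv) in
/-- The set of all interpretations in which all sentences of `Γ` are true. -/
def Mod (Γ : Set (FOFormula L 0)) : Set (Interp L eqv) := {I | ∀ φ ∈ Γ, I.Models φ}

variable (eqv) in
/-- First-order entailment. -/
def Entails (Γ : Set (FOFormula L 0)) (φ : FOFormula L 0) : Prop :=
  ∀ I : Interp L eqv, I ∈ Mod eqv Γ → I.Models φ

variable (eqv) in
/-- First-order satisfiability. -/
def Satisfiable (Γ : Set (FOFormula L 0)) : Prop := (Mod eqv Γ).Nonempty

/-- The partition `(T, P)` is induced by the interpretation pair `(M, N)`: it collects the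
`K`-atoms that are true, and the ones that are not false, with respect to `(M, N)`. -/
def IsInducedPartition (K : KB L) (M N : Set (Interp L eqv)) (T P : Set K.KA) : Prop :=
  ∀ a : K.KA,
    (a ∈ T ↔ ∀ I ∈ M, a.val.know.value I (M, N) (M, N) = TV.t) ∧
    (a ∉ P ↔ ∀ I ∈ M, a.val.know.value I (M, N) (M, N) = TV.f) ∧
    (a ∈ P \ T ↔ ∀ I ∈ M, a.val.know.value I (M, N) (M, N) = TV.u)

/-! ### Stable fixpoints and the approximator -/

/-- `(x, y)` is a consistent stable fixpoint of the operator `A` on `α × α`: `x ≤ y`, the operator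
`z ↦ A (z, y)₁` is internal in `[⊥, y]` with least fixpoint `x`, and the operator `z ↦ A (x, z)₂`
is internal in `[x, ⊤]` with least fixpoint `y`. -/
def IsConsistentStableFixpoint {α : Type*} [CompleteLattice α] (A : α × α → α × α)
    (x y : α) : Prop :=
  x ≤ y ∧
  Set.MapsTo (fun z => (A (z, y)).1) (Set.Icc ⊥ y) (Set.Icc ⊥ y) ∧
  IsLeast {z | z ∈ Set.Icc ⊥ y ∧ (A (z, y)).1 = z} x ∧
  Set.MapsTo (fun z => (A (x, z)).2) (Set.Icc x ⊤) (Set.Icc x ⊤) ∧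
  IsLeast {z | z ∈ Set.Icc x ⊤ ∧ (A (x, z)).2 = z} y

namespace KB

variable (eqv) in
/-- The approximator of Knorr, Alferes and Hitzler. -/
def Phi (K : KB L) (X : Set K.KA × Set K.KA) : Set K.KA × Set K.KA :=
  ({a | Entails eqv (K.OB X.1) a.val.toFO} ∪
    {a | ∃ r ∈ K.rules, r.head = a.val ∧
      (∀ b : K.KA, b.val ∈ r.pos → b ∈ X.1) ∧ (∀ b : K.KA, b.val ∈ r.neg → b ∉ X.2)},
   {a | Entails eqv (K.OB X.2) a.val.toFO} ∪
    {a | ∃ r ∈ K.rules, r.head = a.val ∧ ¬ Entails eqv (K.OB X.1) (.neg a.val.toFO) ∧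
      (∀ b : K.KA, b.val ∈ r.pos → b ∈ X.2) ∧ (∀ b : K.KA, b.val ∈ r.neg → b ∉ X.1)})

variable (eqv) in
theorem phi_fst_monotone (K : KB L) (Y : Set K.KA) :
    Monotone (fun X : Set K.KA => (K.Phi eqv (X, Y)).1) := by
  rintro X X' h a (ha | ⟨r, hr, hh, hp, hn⟩)
  · refine Or.inl fun I hI => ha I fun φ hφ => hI φ ?_
    rcases hφ with hφ | ⟨b, hb, rfl⟩
    · exact Or.inl hφ
    · exact Or.inr ⟨b, h hb, rfl⟩
  · exact Or.inr ⟨r, hr, hh, fun b hb => h (hp b hb), hn⟩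

variable (eqv) in
/-- The least fixpoint of `X ↦ Φ (X, Y)₁` on the lattice of all sets of `K`-atoms. -/
def lfpPhiFst (K : KB L) (Y : Set K.KA) : Set K.KA :=
  OrderHom.lfp ⟨fun X => (K.Phi eqv (X, Y)).1, K.phi_fst_monotone eqv Y⟩

end KB

end MKNF

namespace MKNF

/-! ### Evaluating knowledge bases -/

section Evaluation

variable {L : FirstOrder.Language} {eqv : Option (L.Relations 2)}

/-! The value of the knowledge base's formula at `⟨M', N'⟩`, `⟨M, N⟩` depends only on whether `M'`
consists of models of the ontology and on the known `K`-atoms: those of `M'` must be closed under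
the rules reduced by those of `N`, and those of `N'` under the rules reduced by those of `M`
(`KB.value_toFormula_eq_t_iff`). Prefixpoints of `Φ(·, P)₁` are the sets closed under entailment and
under these reduced rules, and larger sets of interpretations know fewer atoms. So maximality of
`(M, N)` translates into leastness of `T` and `P`.

What remains is the condition in `Φ₂` that `T` does not refute the head. For a model it is harmless:
heads that fire hold throughout the nonempty set `N ⊆ M`. For a stable fixpoint, let `S` be the
least fixpoint of `Φ(·, T)₁`, which lacks that condition. Then `T` and `P` lie in `S`, so a model of
the objective knowledge of `S` shows both that `N` is nonempty and that no head in `S` is refuted by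
`T`. -/

theorem TV.le_t (a : TV) : a ≤ TV.t := by
  change a.rank ≤ TV.t.rank
  cases a <;> simp [TV.rank]

theorem TV.eq_t_iff (a : TV) : a = TV.t ↔ TV.t ≤ a :=
  ⟨fun h => h.ge, fun h => le_antisymm a.le_t h⟩

theorem TV.t_not_le_f : ¬ TV.t ≤ TV.f := by
  change ¬ TV.t.rank ≤ TV.f.rank
  simp [TV.rank]

theorem TV.u_le_iff (a : TV) : TV.u ≤ a ↔ a ≠ TV.f := by
  change TV.u.rank ≤ a.rank ↔ _
  cases a <;> simp [TV.rank]

/-- Splitting at the thresholds `t` and `u` turns a three-valued implication into two classical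
ones. -/
theorem TV.le_iff (a b : TV) :
    a ≤ b ↔ (TV.t ≤ a → TV.t ≤ b) ∧ (TV.u ≤ a → TV.u ≤ b) := by
  change a.rank ≤ b.rank ↔
    (TV.t.rank ≤ a.rank → TV.t.rank ≤ b.rank) ∧ (TV.u.rank ≤ a.rank → TV.u.rank ≤ b.rank)
  cases a <;> cases b <;> simp [TV.rank]

open Classical in
/-- First-order formulas are two-valued. -/
theorem FOFormula.eval_toFormula (MM NN : Set (Interp L eqv) × Set (Interp L eqv))
    (I : Interp L eqv) {n : ℕ} (φ : FOFormula L n) (x : Fin n → Univ L) :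
    φ.toFormula.eval MM NN I x = if φ.Realize I x then TV.t else TV.f := by
  induction φ with
  | top => simp [toFormula, Formula.eval, Realize]
  | rel R ts => rfl
  | neg φ ih =>
    by_cases h : φ.Realize I x <;> simp [toFormula, Formula.eval, Realize, ih, h]
  | conj φ ψ ih₁ ih₂ =>
    by_cases h₁ : φ.Realize I x <;> by_cases h₂ : ψ.Realize I x <;>
      simp [toFormula, Formula.eval, Realize, ih₁, ih₂, h₁, h₂, TV.le_t]
  | impl φ ψ ih₁ ih₂ =>
    by_cases h₁ : φ.Realize I x <;> by_cases h₂ : ψ.Realize I x <;>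
      simp [toFormula, Formula.eval, Realize, ih₁, ih₂, h₁, h₂, TV.t_not_le_f, TV.le_t]
  | ex φ ih =>
    have hu : ∀ p : Prop, (if p then TV.t else TV.f) ≠ TV.u := fun p => by split_ifs <;> simp
    by_cases h : ∃ α : Univ L, φ.Realize I (Fin.snoc x α) <;>
      simp [toFormula, Formula.eval, Realize, ih, h, hu]

theorem FOFormula.eval_toFormula_eq_t_iff (MM NN : Set (Interp L eqv) × Set (Interp L eqv))
    (I : Interp L eqv) (φ : FOFormula L 0) :
    φ.toFormula.eval MM NN I Fin.elim0 = TV.t ↔ I.Models φ := by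
  rw [eval_toFormula, Interp.Models]
  split_ifs with h <;> simp [h]

theorem FOFormula.eval_toFormula_eq_f_iff (MM NN : Set (Interp L eqv) × Set (Interp L eqv))
    (I : Interp L eqv) (φ : FOFormula L 0) :
    φ.toFormula.eval MM NN I Fin.elim0 = TV.f ↔ ¬ I.Models φ := by
  rw [eval_toFormula, Interp.Models]
  split_ifs with h <;> simp [h]

theorem FOFormula.t_le_value_know (φ : FOFormula L 0) (I : Interp L eqv)
    (MM NN : Set (Interp L eqv) × Set (Interp L eqv)) :
    TV.t ≤ (Formula.know φ.toFormula).value I MM NN ↔ ∀ J ∈ MM.1, J.Models φ := by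
  rw [← TV.eq_t_iff]
  simp only [← eval_toFormula_eq_t_iff MM NN, Formula.value, Formula.eval]
  split_ifs with h₁ h₂ <;> simp_all

/-- The inclusion matters because `eval` tests truth on `MM.1` before looking at `MM.2`. -/
theorem FOFormula.u_le_value_know (φ : FOFormula L 0) (I : Interp L eqv)
    {MM : Set (Interp L eqv) × Set (Interp L eqv)} (hMM : MM.2 ⊆ MM.1)
    (NN : Set (Interp L eqv) × Set (Interp L eqv)) :
    TV.u ≤ (Formula.know φ.toFormula).value I MM NN ↔ ∀ J ∈ MM.2, J.Models φ := by
  rw [TV.u_le_iff]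
  simp only [← eval_toFormula_eq_t_iff MM NN, Formula.value, Formula.eval]
  split_ifs with h₁ h₂
  · simpa [eval_toFormula_eq_t_iff] using fun J hJ => h₁ J (hMM hJ)
  · simpa [eval_toFormula_eq_t_iff, eval_toFormula_eq_f_iff] using h₂
  · simpa [eval_toFormula_eq_t_iff, eval_toFormula_eq_f_iff] using h₂

theorem FOFormula.t_le_value_naf (φ : FOFormula L 0) (I : Interp L eqv)
    (MM NN : Set (Interp L eqv) × Set (Interp L eqv)) :
    TV.t ≤ (Formula.naf φ.toFormula).value I MM NN ↔ ¬ ∀ J ∈ NN.2, J.Models φ := by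
  rw [← TV.eq_t_iff]
  simp only [← eval_toFormula_eq_t_iff MM NN, Formula.value, Formula.eval]
  split_ifs with h₁ h₂ <;>
    simpa [eval_toFormula_eq_t_iff, eval_toFormula_eq_f_iff] using h₁

theorem FOFormula.u_le_value_naf (φ : FOFormula L 0) (I : Interp L eqv)
    (MM : Set (Interp L eqv) × Set (Interp L eqv))
    {NN : Set (Interp L eqv) × Set (Interp L eqv)} (hNN : NN.2 ⊆ NN.1) :
    TV.u ≤ (Formula.naf φ.toFormula).value I MM NN ↔ ¬ ∀ J ∈ NN.1, J.Models φ := by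
  rw [TV.u_le_iff]
  simp only [← eval_toFormula_eq_t_iff MM NN, Formula.value, Formula.eval]
  split_ifs with h₁ h₂
  · obtain ⟨J, hJ, h⟩ := h₁
    simpa [eval_toFormula_eq_t_iff] using ⟨J, hNN hJ, (eval_toFormula_eq_f_iff _ _ _ _).1 h⟩
  · simpa [eval_toFormula_eq_t_iff, eval_toFormula_eq_f_iff] using h₂
  · simpa [eval_toFormula_eq_t_iff, eval_toFormula_eq_f_iff] using h₂

theorem le_value_bigConj (c : TV) (l : List (Formula L 0)) (I : Interp L eqv)
    (MM NN : Set (Interp L eqv) × Set (Interp L eqv)) :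
    c ≤ (bigConj l).value I MM NN ↔ ∀ φ ∈ l, c ≤ φ.value I MM NN := by
  induction l with
  | nil => simp [bigConj, Formula.value, Formula.eval, TV.le_t]
  | cons φ l ih =>
    rw [List.forall_mem_cons, ← ih]
    exact le_min_iff

/-- Threshold `t` gives the first implication and threshold `u` the second; `not` reads its
components in the opposite order to `K`. -/
theorem Rule.value_toFormula_eq_t_iff (r : Rule L) (I : Interp L eqv)
    {MM NN : Set (Interp L eqv) × Set (Interp L eqv)} (hMM : MM.2 ⊆ MM.1) (hNN : NN.2 ⊆ NN.1) :
    r.toFormula.value I MM NN = TV.t ↔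
      ((∀ a ∈ r.pos, ∀ J ∈ MM.1, J.Models a.toFO) →
        (∀ b ∈ r.neg, ¬ ∀ J ∈ NN.2, J.Models b.toFO) → ∀ J ∈ MM.1, J.Models r.head.toFO) ∧
      ((∀ a ∈ r.pos, ∀ J ∈ MM.2, J.Models a.toFO) →
        (∀ b ∈ r.neg, ¬ ∀ J ∈ NN.1, J.Models b.toFO) → ∀ J ∈ MM.2, J.Models r.head.toFO) := by
  have himpl : ∀ φ ψ : Formula L 0, (Formula.impl φ ψ).value I MM NN = TV.t ↔
      φ.value I MM NN ≤ ψ.value I MM NN := by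
    intro φ ψ
    simp [Formula.value, Formula.eval]
  rw [Rule.toFormula, himpl, TV.le_iff, le_value_bigConj, le_value_bigConj]
  simp only [List.forall_mem_append, List.forall_mem_map, GroundAtom.know, GroundAtom.naf,
    FOFormula.t_le_value_know, FOFormula.u_le_value_know _ I hMM,
    FOFormula.t_le_value_naf, FOFormula.u_le_value_naf _ I _ hNN, and_imp]

/-! ### Knowledge bases in terms of known atoms -/

namespace KB

/-- The `K`-atoms of a knowledge base that are known in a set of interpretations. -/
def known (K : KB L) (M : Set (Interp L eqv)) : Set K.KA := {a | ∀ J ∈ M, J.Models a.val.toFO}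

theorem known_anti (K : KB L) {M N : Set (Interp L eqv)} (h : N ⊆ M) : K.known M ⊆ K.known N :=
  fun _ ha J hJ => ha J (h hJ)

/-- The set `X` contains the head of each rule whose positive body is contained in `X` and whose
negative body is disjoint from `Y`. -/
def RuleClosed (K : KB L) (X Y : Set K.KA) : Prop :=
  ∀ r ∈ K.rules, ∀ a : K.KA, r.head = a.val → (∀ b : K.KA, b.val ∈ r.pos → b ∈ X) →
    (∀ b : K.KA, b.val ∈ r.neg → b ∉ Y) → a ∈ X

theorem value_toFormula_eq_t_iff (K : KB L) (I : Interp L eqv)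
    {M' N' M N : Set (Interp L eqv)} (h' : N' ⊆ M') (h : N ⊆ M) :
    K.toFormula.value I (M', N') (M, N) = TV.t ↔
      (∀ J ∈ M', J.Models K.onto) ∧ K.RuleClosed (K.known M') (K.known N) ∧
        K.RuleClosed (K.known N') (K.known M) := by
  have hconj : ∀ φ ψ : Formula L 0, TV.t ≤ (Formula.conj φ ψ).value I (M', N') (M, N) ↔
      TV.t ≤ φ.value I (M', N') (M, N) ∧ TV.t ≤ ψ.value I (M', N') (M, N) :=
    fun _ _ => le_min_iff
  rw [TV.eq_t_iff, toFormula, hconj, le_value_bigConj, FOFormula.t_le_value_know]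
  refine and_congr_right fun _ => ?_
  simp only [List.forall_mem_map, Finset.mem_toList, ← TV.eq_t_iff,
    Rule.value_toFormula_eq_t_iff (MM := (M', N')) (NN := (M, N)) _ I h' h]
  constructor
  · intro H
    constructor
    · intro r hr a ha hp hn
      change ∀ J ∈ M', J.Models a.val.toFO
      rw [← ha]
      exact (H r hr).1 (fun b hb => hp ⟨b, r, hr, Or.inr (Or.inl hb)⟩ hb)
        (fun b hb => hn ⟨b, r, hr, Or.inr (Or.inr hb)⟩ hb)
    · intro r hr a ha hp hn
      change ∀ J ∈ N', J.Models a.val.toFO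
      rw [← ha]
      exact (H r hr).2 (fun b hb => hp ⟨b, r, hr, Or.inr (Or.inl hb)⟩ hb)
        (fun b hb => hn ⟨b, r, hr, Or.inr (Or.inr hb)⟩ hb)
  · rintro ⟨H₁, H₂⟩ r hr
    exact ⟨fun hp hn => H₁ r hr ⟨r.head, r, hr, Or.inl rfl⟩ rfl (fun b hb => hp b.val hb)
        (fun b hb => hn b.val hb),
      fun hp hn => H₂ r hr ⟨r.head, r, hr, Or.inl rfl⟩ rfl (fun b hb => hp b.val hb)
        (fun b hb => hn b.val hb)⟩

/-- Values of modal atoms do not depend on `I`, so over the nonempty set `M` the quantifier can be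
dropped. -/
theorem isInducedPartition_iff (K : KB L) {M N : Set (Interp L eqv)} (h : IsInterpPair M N)
    (T P : Set K.KA) :
    IsInducedPartition K M N T P ↔ T = K.known M ∧ P = K.known N := by
  obtain ⟨I₀, hI₀⟩ := h.1
  have hM : M.Nonempty := ⟨I₀, h.2 hI₀⟩
  have ht : ∀ (a : K.KA) I, a.val.know.value I (M, N) (M, N) = TV.t ↔ a ∈ K.known M :=
    fun a I => by
      rw [TV.eq_t_iff]
      exact FOFormula.t_le_value_know _ I (M, N) (M, N)
  have hf : ∀ (a : K.KA) I, a.val.know.value I (M, N) (M, N) = TV.f ↔ a ∉ K.known N :=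
    fun a I => by
      rw [← not_iff_not, not_not, ← ne_eq, ← TV.u_le_iff]
      exact FOFormula.u_le_value_know _ I (MM := (M, N)) h.2 (M, N)
  have hu : ∀ (a : K.KA) I, a.val.know.value I (M, N) (M, N) = TV.u ↔
      a ∈ K.known N \ K.known M := fun a I => by
    rw [Set.mem_sdiff, ← ht a I, ← not_not (a := a ∈ K.known N), ← hf a I]
    cases a.val.know.value I (M, N) (M, N) <;> simp
  have hc : ∀ p : Prop, (∀ I ∈ M, p) ↔ p :=
    fun p => ⟨fun H => H I₀ (h.2 hI₀), fun H _ _ => H⟩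
  simp only [IsInducedPartition, ht, hf, hu, hc]
  constructor
  · intro H
    exact ⟨Set.ext fun a => (H a).1, Set.ext fun a => not_iff_not.1 (H a).2.1⟩
  · rintro ⟨rfl, rfl⟩ a
    exact ⟨Iff.rfl, Iff.rfl, Iff.rfl⟩

/-! ### Objective knowledge -/

theorem mem_mod_OB (K : KB L) (S : Set K.KA) (I : Interp L eqv) :
    I ∈ Mod eqv (K.OB S) ↔ I.Models K.onto ∧ ∀ a ∈ S, I.Models a.val.toFO := by
  constructor
  · exact fun h => ⟨h _ (Or.inl rfl), fun a ha => h _ (Or.inr ⟨a, ha, rfl⟩)⟩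
  · rintro ⟨h₀, h⟩ φ (rfl | ⟨a, ha, rfl⟩)
    exacts [h₀, h a ha]

theorem mod_OB_anti (K : KB L) {S S' : Set K.KA} (h : S ⊆ S') :
    Mod eqv (K.OB S') ⊆ Mod eqv (K.OB S) := fun I hI => by
  rw [mem_mod_OB] at hI ⊢
  exact ⟨hI.1, fun a ha => hI.2 a (h ha)⟩

theorem subset_known_mod_OB (K : KB L) (S : Set K.KA) : S ⊆ K.known (Mod eqv (K.OB S)) :=
  fun a ha I hI => ((K.mem_mod_OB S I).1 hI).2 a ha

theorem subset_mod_OB (K : KB L) {M : Set (Interp L eqv)} {S : Set K.KA}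
    (h₀ : ∀ J ∈ M, J.Models K.onto) (h : S ⊆ K.known M) : M ⊆ Mod eqv (K.OB S) :=
  fun J hJ => (K.mem_mod_OB S J).2 ⟨h₀ J hJ, fun _ ha => h ha J hJ⟩

/-- This is the closure identity of the Galois connection between `K.known` and `S ↦ Mod eqv (K.OB
S)`. -/
theorem known_mod_OB_known (K : KB L) {M : Set (Interp L eqv)}
    (h₀ : ∀ J ∈ M, J.Models K.onto) :
    K.known (Mod eqv (K.OB (K.known M))) = K.known M :=
  Set.Subset.antisymm (K.known_anti (K.subset_mod_OB h₀ subset_rfl)) (K.subset_known_mod_OB _)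

/-! ### The approximator -/

theorem phi_fst_subset_iff (K : KB L) (X Y Z : Set K.KA) :
    (K.Phi eqv (X, Y)).1 ⊆ Z ↔ K.known (Mod eqv (K.OB X)) ⊆ Z ∧
      ∀ r ∈ K.rules, ∀ a : K.KA, r.head = a.val → (∀ b : K.KA, b.val ∈ r.pos → b ∈ X) →
        (∀ b : K.KA, b.val ∈ r.neg → b ∉ Y) → a ∈ Z := by
  refine Set.union_subset_iff.trans (and_congr_right fun _ => ?_)
  exact ⟨fun H r hr a ha hp hn => H ⟨r, hr, ha, hp, hn⟩,
    fun H a ⟨r, hr, ha, hp, hn⟩ => H r hr a ha hp hn⟩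

theorem phi_snd_subset_iff (K : KB L) (X Y Z : Set K.KA) :
    (K.Phi eqv (X, Y)).2 ⊆ Z ↔ K.known (Mod eqv (K.OB Y)) ⊆ Z ∧
      ∀ r ∈ K.rules, ∀ a : K.KA, r.head = a.val →
        ¬ Entails eqv (K.OB X) (.neg a.val.toFO) → (∀ b : K.KA, b.val ∈ r.pos → b ∈ Y) →
        (∀ b : K.KA, b.val ∈ r.neg → b ∉ X) → a ∈ Z := by
  refine Set.union_subset_iff.trans (and_congr_right fun _ => ?_)
  exact ⟨fun H r hr a ha he hp hn => H ⟨r, hr, ha, he, hp, hn⟩,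
    fun H a ⟨r, hr, ha, he, hp, hn⟩ => H r hr a ha he hp hn⟩

/-- Both components of `Φ` are inflationary in the iterated argument, so their prefixpoints are
fixpoints. -/
theorem subset_phi_fst (K : KB L) (X Y : Set K.KA) : X ⊆ (K.Phi eqv (X, Y)).1 :=
  fun _ ha => Or.inl (K.subset_known_mod_OB X ha)

theorem subset_phi_snd (K : KB L) (X Y : Set K.KA) : Y ⊆ (K.Phi eqv (X, Y)).2 :=
  fun _ ha => Or.inl (K.subset_known_mod_OB Y ha)

theorem phi_fst_anti_snd (K : KB L) (X : Set K.KA) {Y Y' : Set K.KA} (h : Y ⊆ Y') :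
    (K.Phi eqv (X, Y')).1 ⊆ (K.Phi eqv (X, Y)).1 := by
  rintro a (ha | ⟨r, hr, hh, hp, hn⟩)
  · exact Or.inl ha
  · exact Or.inr ⟨r, hr, hh, hp, fun b hb hbY => hn b hb (h hbY)⟩

theorem phi_snd_subset_phi_fst (K : KB L) (X Y : Set K.KA) :
    (K.Phi eqv (X, Y)).2 ⊆ (K.Phi eqv (Y, X)).1 := by
  rintro a (ha | ⟨r, hr, hh, -, hp, hn⟩)
  · exact Or.inl ha
  · exact Or.inr ⟨r, hr, hh, hp, hn⟩

theorem phi_snd_monotone (K : KB L) (X : Set K.KA) :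
    Monotone (fun Y : Set K.KA => (K.Phi eqv (X, Y)).2) := by
  rintro Y Y' h a (ha | ⟨r, hr, hh, he, hp, hn⟩)
  · exact Or.inl (K.known_anti (K.mod_OB_anti h) ha)
  · exact Or.inr ⟨r, hr, hh, he, fun b hb => h (hp b hb), hn⟩

end KB

end Evaluation

/-! ### Least fixpoints in intervals -/

/-- In an interval of a complete lattice, the least fixpoint of a monotone internal operator is
below all prefixpoints in the interval. -/
theorem le_of_isLeast_fixpoint_Icc {α : Type*} [CompleteLattice α] {f : α → α} (hf : Monotone f)
    {a b x z : α} (hmaps : Set.MapsTo f (Set.Icc a b) (Set.Icc a b))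
    (hx : IsLeast {w | w ∈ Set.Icc a b ∧ f w = w} x) (hz : z ∈ Set.Icc a b) (hfz : f z ≤ z) :
    x ≤ z := by
  set w := sInf {y | y ∈ Set.Icc a b ∧ f y ≤ y} with hw
  have hwz : w ≤ z := sInf_le ⟨hz, hfz⟩
  have hwI : w ∈ Set.Icc a b := ⟨le_sInf fun y hy => hy.1.1, hwz.trans hz.2⟩
  have hfw : f w ≤ w := le_sInf fun y hy => (hf (sInf_le hy)).trans hy.2
  have hwf : w ≤ f w := sInf_le ⟨hmaps hwI, hf hfw⟩
  exact (hx.2 ⟨hwI, le_antisymm hfw hwf⟩).trans hwz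

/-- A fixpoint of a monotone operator below which an interval has no other prefixpoint is the least
fixpoint in that interval. -/
theorem isLeast_fixpoint_Icc {α : Type*} [CompleteLattice α] {f : α → α} (hf : Monotone f)
    {a b x : α} (hx : x ∈ Set.Icc a b) (hfx : f x = x)
    (h : ∀ z, a ≤ z → z ≤ x → f z ≤ z → x ≤ z) :
    IsLeast {w | w ∈ Set.Icc a b ∧ f w = w} x := by
  refine ⟨⟨hx, hfx⟩, fun w hw => ?_⟩
  -- The meet of two fixpoints is a prefixpoint below `x`, which forces `x ≤ x ⊓ w`.
  refine (h (x ⊓ w) (le_inf hx.1 hw.1.1) inf_le_left (le_inf ?_ ?_)).trans inf_le_right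
  · exact (hf inf_le_left).trans hfx.le
  · exact (hf inf_le_right).trans hw.2.le

/-! ### Models and stable fixpoints -/

section Main

variable {L : FirstOrder.Language} {eqv : Option (L.Relations 2)}

namespace KB

variable (eqv) in
theorem phi_lfpPhiFst_subset (K : KB L) (Y : Set K.KA) :
    (K.Phi eqv (K.lfpPhiFst eqv Y, Y)).1 ⊆ K.lfpPhiFst eqv Y :=
  (OrderHom.map_lfp ⟨fun X => (K.Phi eqv (X, Y)).1, K.phi_fst_monotone eqv Y⟩).le

variable (eqv) in
theorem lfpPhiFst_subset (K : KB L) {X Y : Set K.KA} (h : (K.Phi eqv (X, Y)).1 ⊆ X) :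
    K.lfpPhiFst eqv Y ⊆ X :=
  OrderHom.lfp_le ⟨fun X => (K.Phi eqv (X, Y)).1, K.phi_fst_monotone eqv Y⟩ h

/-- The three-valued models of a knowledge base, in terms of the `K`-atoms known in a pair. -/
theorem isThreeValuedModel_iff (K : KB L) (M N : Set (Interp L eqv)) :
    IsThreeValuedModel M N K.toFormula ↔
      IsInterpPair M N ∧
      ((∀ J ∈ M, J.Models K.onto) ∧ K.RuleClosed (K.known M) (K.known N) ∧
        K.RuleClosed (K.known N) (K.known M)) ∧
      ∀ M' N' : Set (Interp L eqv), IsInterpPair M' N' → M ⊆ M' → N ⊆ N' →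
        (M = N → M' = N') → (∀ J ∈ M', J.Models K.onto) →
        K.RuleClosed (K.known M') (K.known N) → K.RuleClosed (K.known N') (K.known M) →
        M = M' ∧ N = N' := by
  refine and_congr_right fun hMN => ?_
  have hne : ∀ {M' N' : Set (Interp L eqv)}, IsInterpPair M' N' → M'.Nonempty :=
    fun h => h.1.mono h.2
  refine and_congr ?_ (forall₅_congr fun M' N' hMN' hM hN => ?_)
  · simp only [Satisfies, K.value_toFormula_eq_t_iff _ hMN.2 hMN.2]
    obtain ⟨I, hI⟩ := hne hMN
    exact ⟨fun H => H I hI, fun H _ _ => H⟩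
  · obtain ⟨I, hI⟩ := hne hMN'
    simp only [ne_eq, K.value_toFormula_eq_t_iff _ hMN'.2 hMN.2]
    constructor
    · intro H heq h₁ h₂ h₃
      by_contra hcon
      obtain ⟨J, -, hJ⟩ := H (not_and_or.1 hcon) heq
      exact hJ ⟨h₁, h₂, h₃⟩
    · intro H hor heq
      exact ⟨I, hI, fun ⟨h₁, h₂, h₃⟩ => not_and_or.2 hor (H heq h₁ h₂ h₃)⟩

/-- A prefixpoint `Z` below `T` or `P` yields the larger set `Mod eqv (K.OB Z)`, whose known atoms
are exactly `Z`; maximality of the model then forces equality. -/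
theorem stableFixpoint_of_isThreeValuedModel (K : KB L) {M N : Set (Interp L eqv)}
    {T P : Set K.KA} (hM : M = Mod eqv (K.OB T)) (hN : N = Mod eqv (K.OB P))
    (hT : T = K.known M) (hP : P = K.known N) (h : IsThreeValuedModel M N K.toFormula) :
    IsConsistentStableFixpoint (K.Phi eqv) T P ∧
      Satisfiable eqv (K.OB (K.lfpPhiFst eqv T)) := by
  obtain ⟨hpair, ⟨hO, hcT, hcP⟩, hmin⟩ := (K.isThreeValuedModel_iff M N).1 h
  rw [← hT, ← hP] at hcT hcP
  rw [← hT, ← hP] at hmin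
  have hTP : T ⊆ P := by
    rw [hT, hP]
    exact K.known_anti hpair.2
  have hTM : K.known (Mod eqv (K.OB T)) = T := by rw [← hM, ← hT]
  have hPN : K.known (Mod eqv (K.OB P)) = P := by rw [← hN, ← hP]
  have hMN : M = N → P ⊆ T := fun he => by rw [hT, hP, he]
  have hphiT : (K.Phi eqv (T, P)).1 ⊆ T := (K.phi_fst_subset_iff T P T).2 ⟨hTM.le, hcT⟩
  have hphiP : (K.Phi eqv (T, P)).2 ⊆ P := (K.phi_snd_subset_iff T P P).2
    ⟨hPN.le, fun r hr a ha _ => hcP r hr a ha⟩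
  have hphiPT : (K.Phi eqv (P, T)).1 ⊆ P := (K.phi_fst_subset_iff P T P).2 ⟨hPN.le, hcP⟩
  refine ⟨⟨hTP, ?_, ?_, ?_, ?_⟩, ?_⟩
  · intro X hX
    refine ⟨bot_le, ?_⟩
    exact (K.phi_fst_monotone eqv P hX.2).trans ((K.phi_fst_anti_snd P hTP).trans hphiPT)
  · refine isLeast_fixpoint_Icc (K.phi_fst_monotone eqv P) ⟨bot_le, hTP⟩
      (hphiT.antisymm (K.subset_phi_fst T P)) fun Z _ hZT hZ => ?_
    obtain ⟨hZk, hZc⟩ := (K.phi_fst_subset_iff Z P Z).1 hZ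
    have hZM : K.known (Mod eqv (K.OB Z)) = Z := hZk.antisymm (K.subset_known_mod_OB Z)
    have hsub : M ⊆ Mod eqv (K.OB Z) := hM ▸ K.mod_OB_anti hZT
    have hOZ : ∀ J ∈ Mod eqv (K.OB Z), J.Models K.onto :=
      fun J hJ => ((K.mem_mod_OB Z J).1 hJ).1
    have hcZ : K.RuleClosed (K.known (Mod eqv (K.OB Z))) P := by
      rw [hZM]
      exact hZc
    have key : M = Mod eqv (K.OB Z) := by
      -- If `M = N`, competing pairs must be two-valued, so both components are enlarged at once;
      -- here `T = P`, and the two closure conditions coincide.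
      by_cases he : M = N
      · refine (hmin _ _ ⟨hpair.1.mono (hpair.2.trans hsub), subset_rfl⟩ hsub
          (hpair.2.trans hsub) (fun _ => rfl) hOZ hcZ ?_).1
        rwa [hTP.antisymm (hMN he)]
      · refine (hmin _ N ⟨hpair.1, hpair.2.trans hsub⟩ hsub subset_rfl
          (fun he' => (he he').elim) hOZ hcZ ?_).1
        rwa [← hP]
    rw [hT, key]
    exact hZk
  · intro X hX
    exact ⟨hX.1.trans (K.subset_phi_snd T X), le_top⟩
  · refine isLeast_fixpoint_Icc (K.phi_snd_monotone T) ⟨hTP, le_top⟩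
      (hphiP.antisymm (K.subset_phi_snd T P)) fun Z hTZ hZP hZ => ?_
    by_cases he : M = N
    · exact (hMN he).trans hTZ
    obtain ⟨hZk, hZc⟩ := (K.phi_snd_subset_iff T Z Z).1 hZ
    have hZN : K.known (Mod eqv (K.OB Z)) = Z := hZk.antisymm (K.subset_known_mod_OB Z)
    have hsub : N ⊆ Mod eqv (K.OB Z) := hN ▸ K.mod_OB_anti hZP
    have hcZ : K.RuleClosed (K.known (Mod eqv (K.OB Z))) T := by
      rw [hZN]
      intro r hr a ha hp hn
      -- The head lies in `P`, hence holds at some `J ∈ N ⊆ M`, so `T` cannot entail its negation.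
      refine hZc r hr a ha (fun hent => ?_) hp hn
      have haP : a ∈ P := hcP r hr a ha (fun b hb => hZP (hp b hb)) hn
      obtain ⟨J, hJ⟩ := hpair.1
      rw [hP] at haP
      exact hent J (hM ▸ hpair.2 hJ) (haP J hJ)
    have hcM : K.RuleClosed (K.known M) P := by rwa [← hT]
    have key := (hmin M _ ⟨hpair.1.mono hsub, hM ▸ K.mod_OB_anti hTZ⟩ subset_rfl hsub
      (fun he' => (he he').elim) hO hcM hcZ).2
    rw [hP, key]
    exact hZk
  · refine hpair.1.mono ?_
    rw [hN]
    exact K.mod_OB_anti (K.lfpPhiFst_subset eqv hphiPT)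

theorem isThreeValuedModel_of_stableFixpoint (K : KB L) {M N : Set (Interp L eqv)}
    {T P : Set K.KA} (hM : M = Mod eqv (K.OB T)) (hN : N = Mod eqv (K.OB P))
    (h : IsConsistentStableFixpoint (K.Phi eqv) T P)
    (hsat : Satisfiable eqv (K.OB (K.lfpPhiFst eqv T))) :
    IsThreeValuedModel M N K.toFormula ∧ T = K.known M ∧ P = K.known N := by
  obtain ⟨hTP, hmapT, hleastT, hmapP, hleastP⟩ := h
  set S := K.lfpPhiFst eqv T with hS
  have hSphi : (K.Phi eqv (S, T)).1 ⊆ S := K.phi_lfpPhiFst_subset eqv T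
  have hTleast : ∀ Z, Z ⊆ P → (K.Phi eqv (Z, P)).1 ⊆ Z → T ⊆ Z := fun Z hZP hZ =>
    le_of_isLeast_fixpoint_Icc (K.phi_fst_monotone eqv P) hmapT hleastT ⟨bot_le, hZP⟩ hZ
  have hPleast : ∀ Z, T ⊆ Z → (K.Phi eqv (T, Z)).2 ⊆ Z → P ⊆ Z := fun Z hTZ hZ =>
    le_of_isLeast_fixpoint_Icc (K.phi_snd_monotone T) hmapP hleastP ⟨hTZ, le_top⟩ hZ
  obtain ⟨hTk, hTc⟩ := (K.phi_fst_subset_iff T P T).1 hleastT.1.2.le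
  obtain ⟨hPk, hPc⟩ := (K.phi_snd_subset_iff T P P).1 hleastP.1.2.le
  have hTS : T ⊆ S := by
    -- Leastness of `T` is available only inside `[∅, P]`, hence the intersection with `P`.
    refine (hTleast (S ∩ P) Set.inter_subset_right (Set.subset_inter ?_ ?_)).trans
      Set.inter_subset_left
    · exact (K.phi_fst_monotone eqv P Set.inter_subset_left).trans
        ((K.phi_fst_anti_snd S hTP).trans hSphi)
    · exact (hmapT ⟨bot_le, Set.inter_subset_right⟩).2
  have hPS : P ⊆ S := hPleast S hTS ((K.phi_snd_subset_phi_fst T S).trans hSphi)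
  have hTM : T = K.known M := by
    rw [hM]
    exact (K.subset_known_mod_OB T).antisymm hTk
  have hPN : P = K.known N := by
    rw [hN]
    exact (K.subset_known_mod_OB P).antisymm hPk
  have hpair : IsInterpPair M N := by
    rw [hM, hN]
    exact ⟨hsat.mono (K.mod_OB_anti hPS), K.mod_OB_anti hTP⟩
  refine ⟨(K.isThreeValuedModel_iff M N).2 ⟨hpair, ⟨?_, ?_, ?_⟩, ?_⟩, hTM, hPN⟩
  · rw [hM]
    exact fun J hJ => ((K.mem_mod_OB T J).1 hJ).1
  · rw [← hTM, ← hPN]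
    exact hTc
  · rw [← hTM, ← hPN]
    intro r hr a ha hp hn
    -- The rule also fires in `S`; a model of the objective knowledge of `S` satisfies the head and
    -- that of `T`, so the negated head is not entailed.
    refine hPc r hr a ha (fun hent => ?_) hp hn
    have haS : a ∈ S := ((K.phi_fst_subset_iff S T S).1 hSphi).2 r hr a ha
      (fun b hb => hPS (hp b hb)) hn
    obtain ⟨J, hJ⟩ := hsat
    exact hent J (K.mod_OB_anti hTS hJ) (((K.mem_mod_OB S J).1 hJ).2 a haS)
  · intro M' N' hpair' hMM' hNN' _ hO hcM hcN
    rw [← hPN] at hcM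
    rw [← hTM] at hcN
    have hTM' : T ⊆ K.known M' := by
      -- The atoms known in `M'` form a prefixpoint below `P`, since `N ⊆ M ⊆ M'`. Thus every
      -- interpretation in `M'` satisfies `T`, which gives `M' ⊆ M`.
      refine hTleast _ ?_ ((K.phi_fst_subset_iff _ P _).2 ⟨(K.known_mod_OB_known hO).le, hcM⟩)
      rw [hPN]
      exact K.known_anti (hpair.2.trans hMM')
    have hON : ∀ J ∈ N', J.Models K.onto := fun J hJ => hO J (hpair'.2 hJ)
    have hPN' : P ⊆ K.known N' :=
      hPleast _ (hTM'.trans (K.known_anti hpair'.2)) ((K.phi_snd_subset_iff T _ _).2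
        ⟨(K.known_mod_OB_known hON).le, fun r hr a ha _ => hcN r hr a ha⟩)
    constructor
    · refine hMM'.antisymm ?_
      rw [hM]
      exact K.subset_mod_OB hO hTM'
    · refine hNN'.antisymm ?_
      rw [hN]
      exact K.subset_mod_OB hON hPN'

end KB

end Main

end MKNF

theorem theorem5 {L : FirstOrder.Language} (eqv : Option (L.Relations 2)) (K : MKNF.KB L)
    (T P : Set K.KA) (M N : Set (MKNF.Interp L eqv))
    (hM : M = MKNF.Mod eqv (K.OB T)) (hN : N = MKNF.Mod eqv (K.OB P)) :
    (MKNF.IsThreeValuedModel M N K.toFormula ∧ MKNF.IsInducedPartition K M N T P) ↔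
      (MKNF.IsConsistentStableFixpoint (K.Phi eqv) T P ∧
        MKNF.Satisfiable eqv (K.OB (K.lfpPhiFst eqv T))) := by
  constructor
  · rintro ⟨h, hind⟩
    obtain ⟨hT, hP⟩ := (K.isInducedPartition_iff h.1 T P).1 hind
    exact K.stableFixpoint_of_isThreeValuedModel hM hN hT hP h
  · rintro ⟨h, hsat⟩
    obtain ⟨hmod, hT, hP⟩ := K.isThreeValuedModel_of_stableFixpoint hM hN h hsat
    exact ⟨hmod, (K.isInducedPartition_iff hmod.1 T P).2 ⟨hT, hP⟩⟩
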